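/- Let $G$ be a group and $\varphi$ an automorphism of $G$. Elements $g,f\in G$ are called $\varphi$-twisted conjugate if $\varphi(x)\,g=f\,x$ for some $x\in G$; the number $R(\varphi)\in\{1,2,\dots\}\cup\{\infty\}$ of equivalence classes of this relation is the Reidemeister number of $\varphi$. The group $G$ has the $R_\infty$ property if $R(\varphi)=\infty$ for every automorphism $\varphi$ of $G$. For integers $r,t\ge 1$ let $S_{rt}=F_r/F_r^{(t)}$ be the free solvable group of rank $r$ and class (derived length) $t$, where $F_r$ is the free group of rank $r$ and $F_r^{(0)}=F_r$, $F_r^{(n+1)}=[F_r^{(n)},F_r^{(n)}]$ is its derived series. **Theorem 2.** (1) For every $t\ge 2$ the group $S_{2t}$ has the $R_\infty$ property; in particular, the free metabelian group $M_2=S_{22}$ of rank $2$ has the $R_\infty$ property. (2) For every $t\ge 4$ the group $S_{3t}$ has the $R_\infty$ property. (3) For all integers $r\ge 4$ and $t\ge\log_2(2r+1)$ the group $S_{rt}$ has the $R_\infty$ property. -/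

import Mathlib

/-- The elements `g`, `f` of `G` are `φ`-twisted conjugate when `φ x * g = f * x` for some
`x : G`. This is the resulting equivalence relation on `G`. -/
def twistedConjSetoid {G : Type*} [Group G] (φ : G ≃* G) : Setoid G where
  r g f := ∃ x : G, φ x * g = f * x
  iseqv :=
    { refl := fun g => ⟨1, by simp⟩
      symm := by
        rintro g f ⟨x, hx⟩
        refine ⟨x⁻¹, ?_⟩
        rw [map_inv, inv_mul_eq_iff_eq_mul, ← mul_assoc, hx, mul_inv_cancel_right]
      trans := by
        rintro g f h ⟨x, hx⟩ ⟨y, hy⟩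
        refine ⟨y * x, ?_⟩
        rw [map_mul, mul_assoc, hx, ← mul_assoc, hy, mul_assoc] }

/-- The Reidemeister number `R(φ)`: the number of `φ`-twisted conjugacy classes,
a natural number or `∞`. -/
noncomputable def reidemeisterNumber {G : Type*} [Group G] (φ : G ≃* G) : ℕ∞ :=
  ENat.card (Quotient (twistedConjSetoid φ))

/-- `G` has the `R_∞` property: `R(φ) = ∞` for every automorphism `φ` of `G`. -/
def HasRInfty (G : Type*) [Group G] : Prop :=
  ∀ φ : G ≃* G, reidemeisterNumber φ = ⊤

/-- The free solvable group `S_{rt}` of rank `r` and class (derived length) `t`: the quotient of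
the free group `F` of rank `r` by the `t`-th term of its derived series `F^(0) = F`,
`F^(n+1) = [F^(n), F^(n)]`. -/
abbrev FreeSolvableGroup (r t : ℕ) : Type :=
  FreeGroup (Fin r) ⧸ derivedSeries (FreeGroup (Fin r)) t

/-- The free metabelian group `M_r` of rank `r`, i.e. the free solvable group of class two. -/
abbrev FreeMetabelianGroup (r : ℕ) : Type := FreeSolvableGroup r 2

/-! Every free solvable group of rank and class at least 2 has the property. On `polySubgroup G K n`
a function of degree `n + 1` is additive up to a constant, so it is a character of that layer. If an
automorphism `φ` fixes a nontrivial character of some layer, `reidemeisterNumber_eq_top` gives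
infinitely many twisted classes: take the lowest such layer. Below it `φ^* - 1` is injective, hence
bijective by finite dimensionality, and this forces any `x` that twists one power of `z` to another
into the layer; the invariant character then separates the powers.

Characters come from integrating a 1-form `Q · b` on `ℤ ^ r` along the path of a group element, with
`Q` a product of linear forms and `b` a constant covector. Such integrals factor through a
metabelian group, so class 2 suffices. Modulo lower degree, `φ` acts on these forms through the
transpose of its matrix on the abelianization, and exact forms vanish on closed paths.

If this matrix has two distinct eigenvalues, a product of eigenvectors in which every eigenvalue
occurs twice has weight `det ^ 2 = 1`; with one factor used as `b` and a non-parallel one left in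
`Q`, it is a non-closed invariant form. If there is only one eigenvalue, it is `1` or `-1`. For `1`
a linear character is fixed. For `-1` an eigenvector `e` and a further vector `g` with `N g = -g + c
e` give the form `g · e`, invariant modulo an exact form. -/

/-! ### Polynomial functions on groups and their filtration. -/

section PolynomialFunctions

variable {G H K : Type*} [Group G] [Group H] [Field K]

/-- The functions of degree at most `n` on a group: those killed by `n + 1` successive
left differences `f ↦ (h ↦ f (g * h) - f h)`. -/
def polyFun (G K : Type*) [Group G] [Field K] : ℕ → Submodule K (G → K)
  | 0 =>
    { carrier := {f | ∀ g h, f (g * h) = f h}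
      add_mem' := fun ha hb g h => by simp [ha g h, hb g h]
      zero_mem' := fun g h => rfl
      smul_mem' := fun c f hf g h => by simp [hf g h] }
  | n + 1 =>
    { carrier := {f | ∀ g, (fun h => f (g * h) - f h) ∈ polyFun G K n}
      add_mem' := fun {a b} ha hb g => by
        convert (polyFun G K n).add_mem (ha g) (hb g) using 1
        ext h; simp only [Pi.add_apply]; ring
      zero_mem' := fun g => by
        convert (polyFun G K n).zero_mem using 1
        ext h; simp
      smul_mem' := fun c f hf g => by
        convert (polyFun G K n).smul_mem c (hf g) using 1
        ext h; simp only [Pi.smul_apply, smul_eq_mul]; ring }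

theorem const_mem_polyFun (n : ℕ) (c : K) : (fun _ : G => c) ∈ polyFun G K n := by
  induction n generalizing c with
  | zero => intro g h; rfl
  | succ n ih => intro g; simpa using ih 0

theorem polyFun_le_succ (n : ℕ) : polyFun G K n ≤ polyFun G K (n + 1) := by
  induction n with
  | zero =>
    intro f hf g
    simpa [hf g] using const_mem_polyFun (G := G) 0 (0 : K)
  | succ n ih => exact fun f hf g => ih (hf g)

theorem polyFun_mono {m n : ℕ} (h : m ≤ n) : polyFun G K m ≤ polyFun G K n :=
  monotone_nat_of_le_succ polyFun_le_succ h

theorem polyFun_mul_left {n : ℕ} {f : G → K} (hf : f ∈ polyFun G K n) (g : G) :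
    (fun h => f (g * h)) ∈ polyFun G K n := by
  cases n with
  | zero => simpa only [hf g] using hf
  | succ n =>
    convert (polyFun G K (n + 1)).add_mem (polyFun_le_succ n (hf g)) hf using 1
    ext h; simp

theorem polyFun_mul_right {n : ℕ} {f : G → K} (hf : f ∈ polyFun G K n) (g : G) :
    (fun h => f (h * g)) ∈ polyFun G K n := by
  induction n generalizing f with
  | zero => intro x h; simp only [mul_assoc, hf x]
  | succ n ih => intro x; simpa only [mul_assoc] using ih (hf x)

theorem polyFun_rightDiff {n : ℕ} {f : G → K} (hf : f ∈ polyFun G K (n + 1)) (g : G) :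
    (fun h => f (h * g) - f h) ∈ polyFun G K n := by
  induction n generalizing f with
  | zero =>
    intro x h
    have h1 := hf x (h * g) 1
    have h2 := hf x h 1
    simp only [mul_one, mul_assoc] at *
    linear_combination h1 - h2
  | succ n ih =>
    intro x
    convert ih (hf x) using 1
    ext h; simp only [mul_assoc]; ring

theorem polyFun_comp {n : ℕ} {f : H → K} (hf : f ∈ polyFun H K n) (ψ : G →* H) :
    (fun g => f (ψ g)) ∈ polyFun G K n := by
  induction n generalizing f with
  | zero => intro g h; simp only [map_mul, hf (ψ g)]
  | succ n ih => intro g; simpa only [map_mul] using ih (hf (ψ g))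

theorem polyFun_additive_mul {n : ℕ} {l f : G → K} (hl : ∀ x y, l (x * y) = l x + l y)
    (hf : f ∈ polyFun G K n) : (fun g => l g * f g) ∈ polyFun G K (n + 1) := by
  induction n generalizing f with
  | zero =>
    intro g x h
    simp only [hl, hf x h, hf g h, hf g (x * h)]; ring
  | succ n ih =>
    intro g
    convert (polyFun G K (n + 1)).add_mem (ih (hf g))
      ((polyFun G K (n + 1)).smul_mem (l g) (polyFun_mul_left hf g)) using 1
    ext h; simp only [hl, Pi.add_apply, Pi.smul_apply, smul_eq_mul]; ring

theorem polyFun_prod_additive {ι : Type*} (S : Finset ι) (l : ι → G → K)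
    (hl : ∀ i x y, l i (x * y) = l i x + l i y) :
    (fun g => ∏ i ∈ S, l i g) ∈ polyFun G K S.card := by
  classical
  induction S using Finset.induction_on with
  | empty => simpa using const_mem_polyFun (G := G) 0 (1 : K)
  | insert a S ha ih =>
    simp only [Finset.prod_insert ha, Finset.card_insert_of_notMem ha]
    exact polyFun_additive_mul (hl a) ih

/-- A function is determined by its value at `1` and its differences along finitely many generators,
which have lower degree. -/
theorem finiteDimensional_polyFun [Group.FG G] (n : ℕ) :
    FiniteDimensional K (polyFun G K n) := by
  obtain ⟨S, hS⟩ := Group.fg_def.1 (inferInstance : Group.FG G)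
  have key : ∀ f : G → K, (∀ s ∈ S, ∀ h, f (s * h) = f h) → ∀ g, f g = f 1 := by
    intro f hf g
    have : ∀ h, f (g * h) = f h := by
      have hg : g ∈ Subgroup.closure (S : Set G) := hS ▸ Subgroup.mem_top g
      induction hg using Subgroup.closure_induction with
      | mem x hx => exact hf x hx
      | one => simp
      | mul x y _ _ hx hy => intro h; rw [mul_assoc, hx, hy]
      | inv x _ hx => intro h; rw [← hx, mul_inv_cancel_left]
    simpa using this 1
  induction n with
  | zero =>
    let T : polyFun G K 0 →ₗ[K] K := (LinearMap.proj 1).comp (polyFun G K 0).subtype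
    refine FiniteDimensional.of_injective T ?_
    rw [injective_iff_map_eq_zero]
    rintro ⟨f, hf⟩ h0
    ext g
    have h1 : f 1 = 0 := h0
    have := hf g 1
    rw [mul_one, h1] at this
    exact this
  | succ n ih =>
    let T : polyFun G K (n + 1) →ₗ[K] K × (S → polyFun G K n) :=
      { toFun := fun f => (f.1 1, fun s => ⟨fun h => f.1 (s.1 * h) - f.1 h, f.2 s.1⟩)
        map_add' := fun f g => by
          refine Prod.ext rfl (funext fun s => Subtype.ext (funext fun h => ?_))
          simp; ring
        map_smul' := fun c f => by
          refine Prod.ext rfl (funext fun s => Subtype.ext (funext fun h => ?_))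
          simp; ring }
    refine FiniteDimensional.of_injective T ?_
    rw [injective_iff_map_eq_zero]
    rintro ⟨f, hf⟩ h0
    have h1 : f 1 = 0 := congrArg Prod.fst h0
    have h2 : ∀ s ∈ S, ∀ h, f (s * h) = f h := fun s hs h => by
      have := congrFun (congrArg Subtype.val (congrFun (congrArg Prod.snd h0) ⟨s, hs⟩)) h
      exact sub_eq_zero.1 this
    ext g
    simpa [h1] using key f h2 g

/-- The elements which no function of degree at most `n` distinguishes from `1`. -/
def polySubgroup (G K : Type*) [Group G] [Field K] (n : ℕ) : Subgroup G where
  carrier := {z | ∀ f ∈ polyFun G K n, ∀ g, f (z * g) = f g}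
  mul_mem' := fun ha hb f hf g => by rw [mul_assoc, ha f hf, hb f hf]
  one_mem' := fun f _ g => by rw [one_mul]
  inv_mem' := fun {a} ha f hf g => by rw [← ha f hf, mul_inv_cancel_left]

theorem mem_polySubgroup {n : ℕ} {z : G} :
    z ∈ polySubgroup G K n ↔ ∀ f ∈ polyFun G K n, f z = f 1 :=
  ⟨fun h f hf => by simpa using h f hf 1,
    fun h f hf g => by simpa using h _ (polyFun_mul_right hf g)⟩

theorem polySubgroup_zero : polySubgroup G K 0 = ⊤ :=
  eq_top_iff.2 fun z _ _ hf g => hf z g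

theorem polySubgroup_anti {m n : ℕ} (h : m ≤ n) : polySubgroup G K n ≤ polySubgroup G K m :=
  fun _ hz f hf => hz f (polyFun_mono h hf)

instance polySubgroup_normal (n : ℕ) : (polySubgroup G K n).Normal where
  conj_mem z hz x f hf g := by
    have := hz _ (polyFun_mul_left hf x) (x⁻¹ * g)
    simpa [mul_assoc] using this

theorem map_mem_polySubgroup {n : ℕ} {z : G} (hz : z ∈ polySubgroup G K n) (ψ : G →* H) :
    ψ z ∈ polySubgroup H K n := by
  rw [mem_polySubgroup] at hz ⊢
  intro f hf
  simpa using hz _ (polyFun_comp hf ψ)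

theorem polyFun_succ_apply_mul {n : ℕ} {f : G → K} (hf : f ∈ polyFun G K (n + 1)) {z : G}
    (hz : z ∈ polySubgroup G K n) (g : G) : f (g * z) = f g + f z - f 1 := by
  have := mem_polySubgroup.1 hz _ (hf g)
  simp only [mul_one] at this
  linear_combination this

theorem polyFun_succ_apply_mul' {n : ℕ} {f : G → K} (hf : f ∈ polyFun G K (n + 1)) {z : G}
    (hz : z ∈ polySubgroup G K n) (g : G) : f (z * g) = f z + f g - f 1 := by
  have := mem_polySubgroup.1 hz _ (polyFun_rightDiff hf g)
  simp only [one_mul] at this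
  linear_combination this

/-- A function of degree `n + 1` is additive against elements of the layer on either side, so it
cannot tell `z` from its conjugates. -/
theorem commutator_mem_polySubgroup {n : ℕ} {z : G} (hz : z ∈ polySubgroup G K n) (u : G) :
    u * z * u⁻¹ * z⁻¹ ∈ polySubgroup G K (n + 1) := by
  have hconj := (polySubgroup_normal (G := G) (K := K) n).conj_mem z hz u
  have hw := mul_mem hconj (inv_mem hz)
  rw [mem_polySubgroup]
  intro f hf
  have h1 := polyFun_succ_apply_mul hf hz (u * z * u⁻¹ * z⁻¹)
  have h2 := polyFun_succ_apply_mul' hf hconj u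
  have h3 := polyFun_succ_apply_mul hf hz u
  simp only [inv_mul_cancel_right] at h1 h2
  linear_combination -h1 - h2 + h3

end PolynomialFunctions

/-! ### Invariant characters and Reidemeister numbers. -/

section Reidemeister

variable {G : Type*} [Group G]

theorem reidemeisterNumber_eq_top_of_infinite_invariant {φ : G ≃* G} {s : ℕ → G}
    (hs : ∀ m n, (∃ x, φ x * s m = s n * x) → m = n) : reidemeisterNumber φ = ⊤ := by
  have : Infinite (Quotient (twistedConjSetoid φ)) :=
    Infinite.of_injective (fun n => (Quotient.mk (twistedConjSetoid φ) (s n)))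
      fun m n h => hs m n (Quotient.exact h)
  exact ENat.card_eq_top_of_infinite

variable {K : Type*} [Field K]

/-- On functions of degree `n + 1` modulo those constant on the layer, `φ^* - 1` is an injective
endomorphism of a finite-dimensional space, hence surjective. -/
theorem exists_eq_comp_sub_of_injective [Group.FG G] {φ : G ≃* G} {n : ℕ}
    (hinj : ∀ f ∈ polyFun G K (n + 1), (∀ z ∈ polySubgroup G K n, f (φ z) = f z) →
      ∀ z ∈ polySubgroup G K n, f z = f 1)
    {h : G → K} (hh : h ∈ polyFun G K (n + 1)) :
    ∃ f ∈ polyFun G K (n + 1), ∀ z ∈ polySubgroup G K n,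
      h z - h 1 = f (φ z) - f z := by
  have := finiteDimensional_polyFun (G := G) (K := K) (n + 1)
  let W := polyFun G K (n + 1)
  let N : Submodule K W :=
    { carrier := {f | ∀ z ∈ polySubgroup G K n, f.1 z = f.1 1}
      add_mem' := fun ha hb z hz => by simp [ha z hz, hb z hz]
      zero_mem' := fun z hz => rfl
      smul_mem' := fun c f hf z hz => by simp [hf z hz] }
  let T : W →ₗ[K] W :=
    { toFun := fun f => ⟨fun g => f.1 (φ g), polyFun_comp f.2 φ.toMonoidHom⟩ - f
      map_add' := fun f g => Subtype.ext (funext fun h => by simp; ring)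
      map_smul' := fun c f => Subtype.ext (funext fun h => by simp; ring) }
  have hT : ∀ f : W, ∀ g, (T f).1 g = f.1 (φ g) - f.1 g := fun f g => rfl
  have hTN : N ≤ N.comap T := fun f hf z hz => by
    have h1 : f.1 (φ z) = f.1 1 := hf _ (map_mem_polySubgroup hz φ.toMonoidHom)
    have h2 := hf z hz
    simp only [hT, map_one, sub_self, h1, h2]
  have hker : Function.Injective (N.mapQ N T hTN) := by
    rw [← LinearMap.ker_eq_bot, Submodule.ker_mapQ, eq_bot_iff,
      Submodule.map_le_iff_le_comap, ← LinearMap.ker, Submodule.ker_mkQ]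
    intro f hf
    refine hinj f.1 f.2 fun z hz => ?_
    have := hf z hz
    simpa only [hT, map_one, sub_self, sub_eq_zero] using this
  obtain ⟨q, hq⟩ := (LinearMap.injective_iff_surjective.1 hker) (N.mkQ ⟨h, hh⟩)
  obtain ⟨f, rfl⟩ := N.mkQ_surjective q
  rw [Submodule.mkQ_apply, Submodule.mapQ_apply, Submodule.mkQ_apply, eq_comm,
    Submodule.Quotient.eq] at hq
  refine ⟨f.1, f.2, fun z hz => ?_⟩
  have := hq z hz
  simp only [AddSubgroupClass.coe_sub, Pi.sub_apply, hT, map_one, sub_self, sub_zero] at this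
  linear_combination this

/-- An automorphism of a finitely generated group that fixes a nontrivial character of some layer
of the polynomial filtration has infinite Reidemeister number. -/
theorem reidemeisterNumber_eq_top [Group.FG G] [CharZero K] (φ : G ≃* G) {n : ℕ}
    {f : G → K} (hf : f ∈ polyFun G K (n + 1))
    (hinv : ∀ z ∈ polySubgroup G K n, f (φ z) = f z)
    (hne : ∃ z ∈ polySubgroup G K n, f z ≠ f 1) : reidemeisterNumber φ = ⊤ := by
  induction n using Nat.strong_induction_on generalizing f with
  | _ n IH =>
  -- Reduction to the lowest layer carrying a nontrivial invariant character.
  by_cases hlow : ∃ m < n, ∃ f ∈ polyFun G K (m + 1),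
      (∀ z ∈ polySubgroup G K m, f (φ z) = f z) ∧ ∃ z ∈ polySubgroup G K m, f z ≠ f 1
  · obtain ⟨m, hm, f', hf', h1, h2⟩ := hlow
    exact IH m hm hf' h1 h2
  push Not at hlow
  -- Climbing the filtration: on layer `m`, `h - h 1` is `p ∘ φ - p`, and this vanishes at `x`
  -- because `φ x * x⁻¹` is invisible to `p`.
  have hfix : ∀ x, φ x * x⁻¹ ∈ polySubgroup G K n → ∀ m ≤ n, x ∈ polySubgroup G K m := by
    intro x hx m
    induction m with
    | zero => intro _; rw [polySubgroup_zero]; exact Subgroup.mem_top x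
    | succ m ih =>
      intro hm
      have hxm := ih (by omega)
      rw [mem_polySubgroup]
      intro h hh
      obtain ⟨p, hp, hpz⟩ := exists_eq_comp_sub_of_injective (hlow m hm) hh
      have h1 := (polySubgroup_anti hm hx) p hp x
      rw [inv_mul_cancel_right] at h1
      have h2 := hpz x hxm
      linear_combination h2 + h1
  obtain ⟨z, hz, hfz⟩ := hne
  have hpow : ∀ k : ℕ, f (z ^ k) = f 1 + k * (f z - f 1) := by
    intro k
    induction k with
    | zero => simp
    | succ k ih =>
      rw [pow_succ, polyFun_succ_apply_mul hf hz, ih]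
      push_cast; ring
  refine reidemeisterNumber_eq_top_of_infinite_invariant (s := fun k => z ^ k) ?_
  rintro k l ⟨x, hx⟩
  have hzk := pow_mem hz k
  have hzl := pow_mem hz l
  have hxn : x ∈ polySubgroup G K n := by
    refine hfix x ?_ n le_rfl
    have : φ x * x⁻¹ = z ^ l * (x * (z ^ k)⁻¹ * x⁻¹) := by
      rw [← mul_assoc, ← mul_assoc, ← hx]; group
    rw [this]
    exact mul_mem hzl ((polySubgroup_normal n).conj_mem _ (inv_mem hzk) x)
  have h1 := congrArg f hx
  rw [polyFun_succ_apply_mul hf hzk, polyFun_succ_apply_mul hf hxn, hinv x hxn, hpow, hpow] at h1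
  have h2 : ((k : K) - l) * (f z - f 1) = 0 := by linear_combination h1
  rcases mul_eq_zero.1 h2 with h3 | h3
  · exact_mod_cast sub_eq_zero.1 h3
  · exact absurd (sub_eq_zero.1 h3) hfz

end Reidemeister

/-! ### Integration of 1-forms along paths in an abelian group. -/

section PathGroup

/-- The semidirect product of the functions `V → K` by translations: `shift` is the end point of a
path in `V` starting at `1`, and `fn p` its integral after translation by `p`. -/
@[ext]
structure PathGroup (V K : Type*) where
  shift : V
  fn : V → K

namespace PathGroup

variable {V K : Type*} [CommGroup V] [AddCommGroup K]

instance : Mul (PathGroup V K) where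
  mul a b := ⟨a.shift * b.shift, fun p => a.fn p + b.fn (p * a.shift)⟩

instance : One (PathGroup V K) where
  one := ⟨1, 0⟩

instance : Inv (PathGroup V K) where
  inv a := ⟨a.shift⁻¹, fun p => -a.fn (p * a.shift⁻¹)⟩

@[simp] theorem shift_mul (a b : PathGroup V K) : (a * b).shift = a.shift * b.shift := rfl

@[simp] theorem fn_mul (a b : PathGroup V K) (p : V) :
    (a * b).fn p = a.fn p + b.fn (p * a.shift) := rfl

@[simp] theorem shift_one : (1 : PathGroup V K).shift = 1 := rfl

@[simp] theorem fn_one (p : V) : (1 : PathGroup V K).fn p = 0 := rfl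

@[simp] theorem shift_inv (a : PathGroup V K) : a⁻¹.shift = a.shift⁻¹ := rfl

@[simp] theorem fn_inv (a : PathGroup V K) (p : V) : a⁻¹.fn p = -a.fn (p * a.shift⁻¹) := rfl

instance : Group (PathGroup V K) :=
  Group.ofLeftAxioms
    (fun a b c => by ext <;> simp [mul_assoc, add_assoc])
    (fun a => by ext <;> simp)
    (fun a => by ext <;> simp)

/-- The end point of a path, as a homomorphism. -/
def shiftHom (V K : Type*) [CommGroup V] [AddCommGroup K] : PathGroup V K →* V where
  toFun := shift
  map_one' := rfl
  map_mul' _ _ := rfl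

theorem derivedSeries_two : derivedSeries (PathGroup V K) 2 = ⊥ := by
  have h1 : derivedSeries (PathGroup V K) 1 ≤ (shiftHom V K).ker := by
    rw [derivedSeries_one]
    exact Abelianization.commutator_subset_ker _
  rw [derivedSeries_succ, eq_bot_iff]
  refine (Subgroup.commutator_mono h1 h1).trans ?_
  rw [Subgroup.commutator_le]
  intro a ha b hb
  have ha' : a.shift = 1 := ha
  have hb' : b.shift = 1 := hb
  rw [Subgroup.mem_bot, commutatorElement_eq_one_iff_mul_comm]
  ext <;> simp [ha', hb', add_comm]

end PathGroup

namespace FreeSolvableGroup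

variable {r t : ℕ}

/-- The standard generators of the free solvable group. -/
def gen (t : ℕ) (i : Fin r) : FreeSolvableGroup r t :=
  QuotientGroup.mk (FreeGroup.of i)

theorem closure_range_gen :
    Subgroup.closure (Set.range (gen (r := r) t)) = ⊤ := by
  have h := congrArg (Subgroup.map (QuotientGroup.mk' (derivedSeries (FreeGroup (Fin r)) t)))
    (FreeGroup.closure_range_of (Fin r))
  rw [MonoidHom.map_closure, ← Set.range_comp, Subgroup.map_top_of_surjective _
    (QuotientGroup.mk'_surjective _)] at h
  exact h

theorem hom_ext {H : Type*} [Group H] {a b : FreeSolvableGroup r t →* H}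
    (h : ∀ i, a (gen t i) = b (gen t i)) : a = b := by
  refine MonoidHom.eq_of_eqOn_dense closure_range_gen ?_
  rintro _ ⟨i, rfl⟩
  exact h i

instance : Group.FG (FreeSolvableGroup r t) :=
  Group.fg_iff.2 ⟨Set.range (gen t), closure_range_gen, Set.finite_range _⟩

/-- The homomorphism from a free solvable group to a metabelian group with given values on the
generators. -/
def lift {H : Type*} [Group H] (hH : derivedSeries H 2 = ⊥) (ht : 2 ≤ t) (x : Fin r → H) :
    FreeSolvableGroup r t →* H :=
  QuotientGroup.lift _ (FreeGroup.lift x) fun g hg => by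
    have h1 := map_derivedSeries_le_derivedSeries (FreeGroup.lift x) t
      (Subgroup.mem_map_of_mem _ hg)
    have h2 := derivedSeries_antitone H ht h1
    rwa [hH, Subgroup.mem_bot] at h2

@[simp] theorem lift_gen {H : Type*} [Group H] (hH : derivedSeries H 2 = ⊥) (ht : 2 ≤ t)
    (x : Fin r → H) (i : Fin r) : lift hH ht x (gen t i) = x i := by
  show FreeGroup.lift x (FreeGroup.of i) = x i
  simp

end FreeSolvableGroup

/-- `J g p` behaves like the integral of a `1`-form along the translate by `p` of a path
associated with `g`, which leads from `p` to `p * v g`. -/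
structure IsPathIntegral {G V K : Type*} [Group G] [CommGroup V] [Field K] (v : G →* V)
    (J : G → V → K) : Prop where
  map_mul : ∀ g h p, J (g * h) p = J g p + J h (p * v g)

namespace IsPathIntegral

variable {G V K : Type*} [Group G] [CommGroup V] [Field K] {v : G →* V} {J J' : G → V → K}

theorem map_one (hJ : IsPathIntegral v J) (p : V) : J 1 p = 0 := by
  simpa using hJ.map_mul 1 1 p

theorem map_inv (hJ : IsPathIntegral v J) (g : G) (p : V) : J g⁻¹ p = -J g (p * (v g)⁻¹) := by
  have := hJ.map_mul g⁻¹ g p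
  rw [inv_mul_cancel, hJ.map_one, _root_.map_inv] at this
  linear_combination -this

theorem sub (hJ : IsPathIntegral v J) (hJ' : IsPathIntegral v J') :
    IsPathIntegral v (fun g p => J g p - J' g p) :=
  ⟨fun g h p => by rw [hJ.map_mul, hJ'.map_mul]; ring⟩

theorem comp_translate (hJ : IsPathIntegral v J) (w : V) :
    IsPathIntegral v (fun g p => J g (p * w)) :=
  ⟨fun g h p => by rw [hJ.map_mul, mul_right_comm]⟩

theorem comp_equiv (hJ : IsPathIntegral v J) {φ : G →* G} {A : V →* V}
    (hA : ∀ g, v (φ g) = A (v g)) : IsPathIntegral v (fun g p => J (φ g) (A p)) :=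
  ⟨fun g h p => by rw [_root_.map_mul, hJ.map_mul, _root_.map_mul, hA]⟩

theorem potential (v : G →* V) (W : V → K) : IsPathIntegral v (fun g p => W (p * v g) - W p) :=
  ⟨fun g h p => by rw [_root_.map_mul, mul_assoc]; ring⟩

theorem mem_polyFun_of_closure (hJ : IsPathIntegral v J) {n : ℕ} {s : Set G}
    (hs : Subgroup.closure s = ⊤) (hJs : ∀ g ∈ s, J g ∈ polyFun V K n) (g : G) :
    J g ∈ polyFun V K n := by
  have hg : g ∈ Subgroup.closure s := hs ▸ Subgroup.mem_top g
  induction hg using Subgroup.closure_induction with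
  | mem x hx => exact hJs x hx
  | one =>
    convert (polyFun V K n).zero_mem using 1
    ext p; exact hJ.map_one p
  | mul x y _ _ hx hy =>
    convert (polyFun V K n).add_mem hx (polyFun_mul_right hy (v x)) using 1
    ext p; exact hJ.map_mul x y p
  | inv x _ hx =>
    convert (polyFun V K n).neg_mem (polyFun_mul_right hx (v x)⁻¹) using 1
    ext p; exact hJ.map_inv x p

/-- Differencing in the group element translates the base point: up to a constant, the result is the
integral of a difference of the form, whose degree is one less. -/
theorem eval_mem_polyFun (hJ : IsPathIntegral v J) {n : ℕ} (hn : ∀ g, J g ∈ polyFun V K n)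
    (p : V) : (fun g => J g p) ∈ polyFun G K (n + 1) := by
  induction n generalizing J p with
  | zero =>
    intro g x h
    have h1 := hn (x * h) (v g) p
    have h2 := hn h (v g) p
    simp only [hJ.map_mul g, mul_comm p, h1, h2]
    ring
  | succ n ih =>
    intro g
    have hd : (fun h => J h (p * v g) - J h p) ∈ polyFun G K (n + 1) :=
      ih ((hJ.comp_translate (v g)).sub hJ) (fun h => by
        have := hn h (v g)
        simpa only [mul_comm (v g)] using this) p
    convert (polyFun G K (n + 1)).add_mem (const_mem_polyFun (n + 1) (J g p)) hd using 1
    ext h; simp only [hJ.map_mul g, Pi.add_apply]; ring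

end IsPathIntegral

end PathGroup

/-! ### Products of linear forms and their directional derivatives. -/

section ProductsOfLinearForms

open Polynomial

variable {ι K : Type*} [Field K]

theorem natDegree_prod_linear_le (S : Finset ι) (b c : ι → K) :
    (∏ i ∈ S, (C (b i) * X + C (c i))).natDegree ≤ S.card := by
  refine (natDegree_prod_le _ _).trans ?_
  refine (Finset.sum_le_card_nsmul S _ 1 fun i _ => natDegree_linear_le).trans ?_
  simp

variable [DecidableEq ι]

theorem coeff_card_prod_linear (S : Finset ι) (b c : ι → K) :
    (∏ i ∈ S, (C (b i) * X + C (c i))).coeff S.card = ∏ i ∈ S, b i := by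
  induction S using Finset.induction_on with
  | empty => simp
  | insert a S ha ih =>
    have h0 : (∏ i ∈ S, (C (b i) * X + C (c i))).coeff (S.card + 1) = 0 :=
      coeff_eq_zero_of_natDegree_lt (Nat.lt_succ_of_le (natDegree_prod_linear_le S b c))
    rw [Finset.prod_insert ha, Finset.prod_insert ha, Finset.card_insert_of_notMem ha, add_mul,
      mul_assoc, coeff_add, coeff_C_mul, coeff_C_mul, coeff_X_mul, ih, h0, mul_zero, add_zero]

theorem coeff_card_X_mul_prod_linear (S : Finset ι) (b c : ι → K) :
    (X * ∏ i ∈ S, (C (b i) * X + C (c i))).coeff S.card =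
      ∑ i ∈ S, c i * ∏ j ∈ S.erase i, b j := by
  induction S using Finset.induction_on with
  | empty => simp
  | insert a S ha ih =>
    rw [Finset.prod_insert ha, Finset.card_insert_of_notMem ha, coeff_X_mul, add_mul, mul_assoc,
      coeff_add, coeff_C_mul, coeff_C_mul, ih, coeff_card_prod_linear, Finset.sum_insert ha,
      Finset.erase_insert ha, add_comm, Finset.mul_sum]
    congr 1
    refine Finset.sum_congr rfl fun i hi => ?_
    have hia : a ≠ i := fun h => ha (h ▸ hi)
    rw [Finset.erase_insert_of_ne hia, Finset.prod_insert (fun h => ha (Finset.mem_of_mem_erase h))]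
    ring

/-- If a directional derivative of a product of linear forms vanishes at the integral points, then
it vanishes in no direction transverse to one of the forms. -/
theorem exists_int_dirDeriv_prod_ne_zero [CharZero K] {r : ℕ} {S : Finset ι} {l : ι → Fin r → K}
    (hl : ∀ i ∈ S, l i ≠ 0) {w : Fin r → K} {i₀ : ι} (hi₀ : i₀ ∈ S) (hw : l i₀ ⬝ᵥ w ≠ 0) :
    ∃ u : Fin r → ℤ,
      ∑ i ∈ S, (l i ⬝ᵥ w) * ∏ j ∈ S.erase i, (l j ⬝ᵥ (fun k => (u k : K))) ≠ 0 := by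
  by_contra! hcon
  let L : ι → MvPolynomial (Fin r) K := fun i => ∑ k, MvPolynomial.C (l i k) * MvPolynomial.X k
  have hL : ∀ i p, MvPolynomial.eval p (L i) = l i ⬝ᵥ p := fun i p => by
    simp [L, dotProduct]
  -- The integers are infinite in `K`, so vanishing at integral points is a polynomial identity.
  have hE : ∑ i ∈ S, MvPolynomial.C (l i ⬝ᵥ w) * ∏ j ∈ S.erase i, L j = 0 := by
    refine MvPolynomial.funext_set (fun _ => Set.range (Int.cast : ℤ → K))
      (fun _ => Set.infinite_range_of_injective Int.cast_injective) fun x hx => ?_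
    choose u hu using fun k => hx k (Set.mem_univ k)
    have hux : (fun k => (u k : K)) = x := funext hu
    have := hcon u
    rw [hux] at this
    simpa [hL, MvPolynomial.eval_sum, MvPolynomial.eval_prod] using this
  have hE' : ∀ p : Fin r → K, ∑ i ∈ S, (l i ⬝ᵥ w) * ∏ j ∈ S.erase i, (l j ⬝ᵥ p) = 0 := fun p => by
    simpa [hL, MvPolynomial.eval_sum, MvPolynomial.eval_prod] using
      congrArg (MvPolynomial.eval p) hE
  have hQ : ∏ i ∈ S, L i = 0 := by
    refine MvPolynomial.funext fun p => ?_
    rw [MvPolynomial.eval_prod]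
    simp only [hL, map_zero]
    let q : K[X] := ∏ i ∈ S, (C (l i ⬝ᵥ w) * X + C (l i ⬝ᵥ p))
    have hq : ∀ s, q.eval s = ∏ i ∈ S, (l i ⬝ᵥ (p + s • w)) := fun s => by
      simp only [q, eval_prod]
      refine Finset.prod_congr rfl fun i _ => ?_
      simp [dotProduct_add]; ring
    have hder : derivative q = 0 := by
      refine Polynomial.funext fun s => ?_
      rw [derivative_prod_finset, eval_finsetSum, eval_zero, ← hE' (p + s • w)]
      refine Finset.sum_congr rfl fun i _ => ?_
      simp only [eval_mul, eval_prod]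
      rw [mul_comm]
      congr 1
      · simp
      · refine Finset.prod_congr rfl fun j _ => ?_
        simp [dotProduct_add]; ring
    have hconst := derivative_eq_zero.1 hder
    obtain ⟨c, hc⟩ := natDegree_eq_zero.1 hconst
    have h1 := hq 0
    -- The product is constant along the line `p + s • w`, which meets the hyperplane `l i₀ = 0` at
    -- this parameter; so the product vanishes at `p`.
    have h2 := hq (-(l i₀ ⬝ᵥ p) / (l i₀ ⬝ᵥ w))
    rw [← hc, eval_C] at h1 h2
    simp only [zero_smul, add_zero] at h1
    rw [← h1, h2]
    refine Finset.prod_eq_zero hi₀ ?_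
    simp only [dotProduct_add, dotProduct_smul, smul_eq_mul]
    field_simp
    ring
  obtain ⟨i, hi, h0⟩ := Finset.prod_eq_zero_iff.1 hQ
  refine hl i hi (funext fun k => ?_)
  have := hL i (Pi.single k 1)
  rw [h0] at this
  simpa using this.symm

end ProductsOfLinearForms

/-! ### The lattice and its linear forms. -/

/-- The lattice `ℤ ^ r`, written multiplicatively. -/
abbrev IntLattice (r : ℕ) : Type := Multiplicative (Fin r → ℤ)

namespace IntLattice

variable {r : ℕ}

/-- The `j`-th basis vector. -/
def single (j : Fin r) : IntLattice r := Multiplicative.ofAdd (Pi.single j 1)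

/-- The complex coordinates of a lattice point. -/
def toComplex (p : IntLattice r) : Fin r → ℂ := fun k => (p.toAdd k : ℂ)

theorem toComplex_mul (p q : IntLattice r) : toComplex (p * q) = toComplex p + toComplex q := by
  ext k; simp [toComplex]

theorem toComplex_one : toComplex (1 : IntLattice r) = 0 := by
  ext k; simp [toComplex]

theorem toComplex_pow (p : IntLattice r) (n : ℕ) : toComplex (p ^ n) = n • toComplex p := by
  ext k; simp [toComplex]

theorem toComplex_inv (p : IntLattice r) : toComplex p⁻¹ = -toComplex p := by
  ext k; simp [toComplex]

theorem toComplex_single (j : Fin r) : toComplex (single j) = Pi.single j 1 := by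
  ext k
  rcases eq_or_ne k j with rfl | h
  · simp [toComplex, single]
  · simp [toComplex, single, h]

theorem toComplex_injective : Function.Injective (toComplex (r := r)) := fun p q h => by
  refine Multiplicative.toAdd.injective (funext fun k => ?_)
  exact Int.cast_injective (congrFun h k)

theorem derivedSeries_two : derivedSeries (IntLattice r) 2 = ⊥ := by
  refine eq_bot_iff.2 ((derivedSeries_antitone (IntLattice r) one_le_two).trans ?_)
  rw [derivedSeries_one]
  simpa using Abelianization.commutator_subset_ker (MonoidHom.id (IntLattice r))

theorem dotProduct_mem_polyFun (w : Fin r → ℂ) :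
    (fun p : IntLattice r => w ⬝ᵥ toComplex p) ∈ polyFun (IntLattice r) ℂ 1 := by
  intro g x h
  simp only [toComplex_mul, dotProduct_add]
  ring

theorem prod_dotProduct_mem_polyFun {ι : Type*} (S : Finset ι) (l : ι → Fin r → ℂ) :
    (fun p : IntLattice r => ∏ i ∈ S, l i ⬝ᵥ toComplex p) ∈ polyFun (IntLattice r) ℂ S.card :=
  polyFun_prod_additive S (fun i p => l i ⬝ᵥ toComplex p) fun i x y => by
    simp only [toComplex_mul, dotProduct_add]

end IntLattice

/-! ### Path integrals on free solvable groups. -/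

namespace FreeSolvableGroup

open IntLattice

variable {r t : ℕ}

/-- The projection of a free solvable group onto its abelianization. -/
def coords (ht : 2 ≤ t) : FreeSolvableGroup r t →* IntLattice r :=
  lift IntLattice.derivedSeries_two ht single

@[simp] theorem coords_gen (ht : 2 ≤ t) (i : Fin r) : coords ht (gen t i) = single i :=
  lift_gen _ _ _ _

theorem coords_surjective (ht : 2 ≤ t) : Function.Surjective (coords (r := r) ht) := by
  intro u
  have hu : u = ∏ j, single j ^ (u.toAdd j) := by
    refine Multiplicative.toAdd.injective (funext fun k => ?_)
    simp [single, toAdd_prod, Finset.sum_apply, Pi.single_apply]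
  have hmem : u ∈ (coords (r := r) ht).range := by
    rw [hu]
    refine Subgroup.prod_mem _ fun j _ => Subgroup.zpow_mem _ ?_ _
    exact MonoidHom.mem_range.2 ⟨gen t j, coords_gen ht j⟩
  exact hmem

/-- The integral of the `1`-form `Q · b` along the paths representing the elements of a free
solvable group. -/
def pathIntegral (ht : 2 ≤ t) (Q : IntLattice r → ℂ) (b : Fin r → ℂ) (g : FreeSolvableGroup r t)
    (p : IntLattice r) : ℂ :=
  (lift PathGroup.derivedSeries_two ht (fun i => ⟨single i, fun p => Q p * b i⟩) :
    FreeSolvableGroup r t →* PathGroup (IntLattice r) ℂ) g |>.fn p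

variable (ht : 2 ≤ t) (Q : IntLattice r → ℂ) (b : Fin r → ℂ)

@[simp] theorem pathIntegral_gen (i : Fin r) (p : IntLattice r) :
    pathIntegral ht Q b (gen t i) p = Q p * b i := by
  simp [pathIntegral]

theorem isPathIntegral : IsPathIntegral (coords ht) (pathIntegral ht Q b) where
  map_mul g h p := by
    have : (PathGroup.shiftHom (IntLattice r) ℂ).comp
        (lift PathGroup.derivedSeries_two ht (fun i => ⟨single i, fun p => Q p * b i⟩)) =
        coords ht := hom_ext fun i => by simp [PathGroup.shiftHom]
    rw [← this]
    simp [pathIntegral, PathGroup.shiftHom]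

theorem coords_eq_one {n : ℕ} {z : FreeSolvableGroup r t}
    (hz : z ∈ polySubgroup (FreeSolvableGroup r t) ℂ (n + 1)) : coords ht z = 1 := by
  refine toComplex_injective (funext fun k => ?_)
  have h := mem_polySubgroup.1 (polySubgroup_anti (by omega : 1 ≤ n + 1) hz) _
    (polyFun_comp (dotProduct_mem_polyFun (Pi.single k 1)) (coords ht))
  simpa [single_dotProduct] using h

variable {Q}

/-- To top degree `Q` is constant along the path, so only the end point of the path matters there.
-/
theorem pathIntegral_sub_mem_polyFun {m : ℕ} (hQ : Q ∈ polyFun (IntLattice r) ℂ (m + 1))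
    (g : FreeSolvableGroup r t) :
    (fun p => pathIntegral ht Q b g p - Q p * (b ⬝ᵥ toComplex (coords ht g))) ∈
      polyFun (IntLattice r) ℂ m := by
  have hJ := isPathIntegral ht Q b
  have hg : g ∈ Subgroup.closure (Set.range (gen (r := r) t)) :=
    closure_range_gen (r := r) ▸ Subgroup.mem_top g
  induction hg using Subgroup.closure_induction with
  | mem x hx =>
    obtain ⟨i, rfl⟩ := hx
    simpa [toComplex_single] using const_mem_polyFun (G := IntLattice r) m (0 : ℂ)
  | one =>
    simpa [hJ.map_one, toComplex_one] using const_mem_polyFun (G := IntLattice r) m (0 : ℂ)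
  | mul x y _ _ hx hy =>
    convert add_mem (add_mem hx (polyFun_mul_right hy (coords ht x)))
      ((polyFun (IntLattice r) ℂ m).smul_mem (b ⬝ᵥ toComplex (coords ht y)) (hQ (coords ht x))) using 1
    ext p
    simp only [hJ.map_mul, map_mul, toComplex_mul, dotProduct_add, Pi.add_apply, Pi.smul_apply,
      smul_eq_mul, mul_comm (coords ht x)]
    ring
  | inv x _ hx =>
    convert sub_mem (neg_mem (polyFun_mul_right hx (coords ht x)⁻¹))
      ((polyFun (IntLattice r) ℂ m).smul_mem (b ⬝ᵥ toComplex (coords ht x))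
        (hQ (coords ht x)⁻¹)) using 1
    ext p
    simp only [hJ.map_inv, map_inv, toComplex_inv, dotProduct_neg, Pi.sub_apply, Pi.neg_apply,
      Pi.smul_apply, smul_eq_mul, mul_comm (coords ht x)⁻¹]
    ring

/-- If an automorphism fixes the top-degree part of the form `Q · b` up to the differential of a
potential `W`, then it preserves its integrals over the elements of high degree. -/
theorem pathIntegral_invariant {φ : FreeSolvableGroup r t ≃* FreeSolvableGroup r t}
    {A : IntLattice r →* IntLattice r} (hA : ∀ g, coords ht (φ g) = A (coords ht g)) {m : ℕ}
    (hQ : Q ∈ polyFun (IntLattice r) ℂ (m + 1)) (W : IntLattice r → ℂ)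
    (hW : ∀ i, (fun p => Q (A p) * (b ⬝ᵥ toComplex (A (single i))) - Q p * b i -
      (W (p * single i) - W p)) ∈ polyFun (IntLattice r) ℂ m)
    {z : FreeSolvableGroup r t} (hz : z ∈ polySubgroup (FreeSolvableGroup r t) ℂ (m + 1)) :
    pathIntegral ht Q b (φ z) 1 = pathIntegral ht Q b z 1 := by
  have hJ := isPathIntegral ht Q b
  -- The defect of invariance is itself a path integral, of degree at most `m` in the base point; so
  -- its value at `1` has degree at most `m + 1` on the group and dies on `z`. The potential
  -- contributes nothing because `z` is a closed path.
  have hD := ((hJ.comp_equiv (φ := φ.toMonoidHom) hA).sub hJ).sub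
    (IsPathIntegral.potential (coords ht) W)
  have hDg := hD.mem_polyFun_of_closure (n := m) closure_range_gen (by
    rintro _ ⟨i, rfl⟩
    have h1 := polyFun_comp (pathIntegral_sub_mem_polyFun ht b hQ (φ (gen t i))) A
    rw [hA, coords_gen] at h1
    convert add_mem h1 (hW i) using 1
    ext p
    simp only [MulEquiv.toMonoidHom_eq_coe, MonoidHom.coe_coe, pathIntegral_gen, coords_gen,
      Pi.add_apply]
    ring)
  have h := mem_polySubgroup.1 hz _ (hD.eval_mem_polyFun hDg 1)
  simp only [coords_eq_one ht hz, MulEquiv.toMonoidHom_eq_coe, MonoidHom.coe_coe, map_one,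
    mul_one, sub_self, sub_zero, hJ.map_one] at h
  exact sub_eq_zero.1 h

-- The witness is an iterated commutator: each commutator with `g` applies a difference operator to
-- the integral around a unit square, and `k` differences isolate a leading coefficient.
open Polynomial in
theorem exists_pathIntegral_ne {ι : Type*} {S : Finset ι} {l : ι → Fin r → ℂ}
    (hl : ∀ i ∈ S, l i ≠ 0) {k : ℕ} (hS : S.card = k + 1) {i₀ : ι} (hi₀ : i₀ ∈ S) {x y : Fin r}
    (hxy : b x * l i₀ y ≠ b y * l i₀ x) :
    ∃ z ∈ polySubgroup (FreeSolvableGroup r t) ℂ (k + 1),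
      pathIntegral ht (fun p => ∏ i ∈ S, l i ⬝ᵥ toComplex p) b z 1 ≠ 0 := by
  classical
  set Q : IntLattice r → ℂ := fun p => ∏ i ∈ S, l i ⬝ᵥ toComplex p with hQ
  have hJ := isPathIntegral ht Q b
  -- The derivative of `Q` along `w` is the `x`, `y` component of the exterior derivative of `Q ·
  -- b`, up to sign; by `hxy`, `w` is transverse to `l i₀`.
  let w : Fin r → ℂ := b x • Pi.single y 1 - b y • Pi.single x 1
  have hlw : ∀ i, l i ⬝ᵥ w = b x * l i y - b y * l i x := fun i => by
    simp [w, dotProduct_sub, dotProduct_smul]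
  obtain ⟨u, hu⟩ := exists_int_dirDeriv_prod_ne_zero hl (w := w) hi₀ (by
    rw [hlw]; exact sub_ne_zero.2 hxy)
  obtain ⟨g, hg⟩ := coords_surjective ht (Multiplicative.ofAdd u)
  have hgu : toComplex (coords ht g) = fun k => (u k : ℂ) := by rw [hg]; rfl
  let c : ℕ → FreeSolvableGroup r t :=
    fun j => (fun z => g * z * g⁻¹ * z⁻¹)^[j] (gen t y * gen t x * (gen t y)⁻¹ * (gen t x)⁻¹)
  have hc : ∀ j, c (j + 1) = g * c j * g⁻¹ * (c j)⁻¹ := fun j =>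
    Function.iterate_succ_apply' _ _ _
  have hcmem : ∀ j, c j ∈ polySubgroup (FreeSolvableGroup r t) ℂ (j + 1) := by
    intro j
    induction j with
    | zero => exact commutator_mem_polySubgroup (by rw [polySubgroup_zero]; trivial) _
    | succ j ih => rw [hc]; exact commutator_mem_polySubgroup ih g
  let q : (Fin r → ℂ) → ℂ[X] := fun v =>
    ∏ i ∈ S, (C (l i ⬝ᵥ toComplex (coords ht g)) * X + C (l i ⬝ᵥ v))
  have hq : ∀ v (s : ℂ), (q v).eval s = ∏ i ∈ S, l i ⬝ᵥ (s • toComplex (coords ht g) + v) := by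
    intro v s
    rw [eval_prod]
    refine Finset.prod_congr rfl fun i _ => ?_
    rw [eval_add, eval_mul, eval_C, eval_C, eval_X, dotProduct_add, dotProduct_smul, smul_eq_mul,
      mul_comm]
  -- The integral around the unit square at `s` times `coords ht g`; its coefficient of degree `k`
  -- is the derivative of `Q` along `w` at that vector.
  let D : ℂ[X] := C (b x) * (q (Pi.single y 1) - q 0) - C (b y) * (q (Pi.single x 1) - q 0)
  have hDcoeff : D.coeff k ≠ 0 := by
    have hco : ∀ v, (q v).coeff k = ∑ i ∈ S, (l i ⬝ᵥ v) *
        ∏ j ∈ S.erase i, (l j ⬝ᵥ toComplex (coords ht g)) := fun v => by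
      rw [← coeff_card_X_mul_prod_linear, hS, coeff_X_mul]
    have : D.coeff k = ∑ i ∈ S, (l i ⬝ᵥ w) *
        ∏ j ∈ S.erase i, (l j ⬝ᵥ toComplex (coords ht g)) := by
      simp only [D, coeff_sub, coeff_C_mul, hco, Finset.mul_sum, ← Finset.sum_sub_distrib]
      refine Finset.sum_congr rfl fun i _ => ?_
      rw [hlw]
      simp; ring
    rwa [this, hgu]
  have hDdeg : D.natDegree = k := by
    refine natDegree_eq_of_le_of_coeff_ne_zero ?_ hDcoeff
    refine natDegree_le_iff_coeff_eq_zero.2 fun N hN => ?_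
    have hco : ∀ v, (q v - q 0).coeff N = 0 := fun v => by
      rcases (Nat.succ_le_of_lt hN).eq_or_lt with h | h
      · have h1 : N = S.card := by omega
        simp only [coeff_sub, q, h1, coeff_card_prod_linear, sub_self]
      · rw [coeff_sub, coeff_eq_zero_of_natDegree_lt, coeff_eq_zero_of_natDegree_lt, sub_self] <;>
        exact (natDegree_prod_linear_le _ _ _).trans_lt (by omega)
    simp only [D, coeff_sub (C _ * _), coeff_C_mul, hco, mul_zero, sub_self]
  have hval : ∀ j s : ℕ, pathIntegral ht Q b (c j) (coords ht g ^ s) =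
      ((fwdDiff 1)^[j] D.eval) (s : ℂ) := by
    intro j
    induction j with
    | zero =>
      intro s
      have h1 := hJ.map_mul (c 0) (gen t x * gen t y) (coords ht g ^ s)
      have h2 : c 0 * (gen t x * gen t y) = gen t y * gen t x := by
        simp only [c, Function.iterate_zero, id]; group
      rw [h2, coords_eq_one ht (hcmem 0), mul_one, hJ.map_mul, hJ.map_mul] at h1
      simp only [pathIntegral_gen, coords_gen] at h1
      simp only [Function.iterate_zero, id, D, eval_sub, eval_mul, eval_C, hq]
      simp only [hQ, toComplex_mul, toComplex_pow, toComplex_single, Nat.cast_smul_eq_nsmul,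
        add_zero] at h1 ⊢
      linear_combination -h1
    | succ j ih =>
      intro s
      rw [Function.iterate_succ_apply', fwdDiff, ← Nat.cast_succ, ← ih, ← ih, pow_succ]
      have h1 := hJ.map_mul (c (j + 1)) (c j * g) (coords ht g ^ s)
      have h2 : c (j + 1) * (c j * g) = g * c j := by rw [hc]; group
      rw [h2, coords_eq_one ht (hcmem (j + 1)), mul_one, hJ.map_mul, hJ.map_mul,
        coords_eq_one ht (hcmem j), mul_one] at h1
      linear_combination -h1
  refine ⟨c k, hcmem k, ?_⟩
  have h := hval k 0
  rw [pow_zero] at h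
  have h2 := congrFun (fwdDiff_iter_degree_eq_factorial D) (0 : ℂ)
  rw [hDdeg] at h2
  rw [h, Nat.cast_zero, h2, leadingCoeff, hDdeg]
  simpa using ⟨hDcoeff, Nat.factorial_ne_zero k⟩

end FreeSolvableGroup

/-! ### Eigenvectors of integral matrices. -/

namespace Matrix

variable {r : ℕ}

theorem exists_eigenvector_of_mem_roots {N : Matrix (Fin r) (Fin r) ℂ} {a : ℂ}
    (ha : a ∈ N.charpoly.roots) : ∃ v : Fin r → ℂ, v ≠ 0 ∧ N *ᵥ v = a • v := by
  have h := (Polynomial.mem_roots'.1 ha).2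
  rw [Polynomial.IsRoot, eval_charpoly, ← exists_mulVec_eq_zero_iff] at h
  obtain ⟨v, hv, h0⟩ := h
  refine ⟨v, hv, ?_⟩
  rw [sub_mulVec, sub_eq_zero] at h0
  rw [← h0]
  simp [scalar_apply, ← smul_one_eq_diagonal, smul_mulVec]

theorem exists_minor_ne_zero {f g : Fin r → ℂ} (hf : f ≠ 0)
    (hg : g ∉ Submodule.span ℂ {f}) : ∃ x y, f x * g y ≠ f y * g x := by
  by_contra! h
  obtain ⟨x, hx⟩ := Function.ne_iff.1 hf
  refine hg (Submodule.mem_span_singleton.2 ⟨g x / f x, funext fun y => ?_⟩)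
  have := h x y
  rw [Pi.zero_apply] at hx
  rw [Pi.smul_apply, smul_eq_mul]
  field_simp
  linear_combination -this

/-- An integral matrix of determinant `±1` with a single eigenvalue has eigenvalue `1` or `-1`. -/
theorem eq_one_or_neg_one_of_roots_eq {M : Matrix (Fin r) (Fin r) ℤ} (hr : r ≠ 0)
    (hM : M.det ^ 2 = 1) {a : ℂ}
    (ha : (M.map (Int.cast : ℤ → ℂ)).charpoly.roots = Multiset.replicate r a) :
    a = 1 ∨ a = -1 := by
  have htr := trace_eq_sum_roots_charpoly (M.map (Int.cast : ℤ → ℂ))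
  have hdet := det_eq_prod_roots_charpoly (M.map (Int.cast : ℤ → ℂ))
  rw [ha, Multiset.sum_replicate, nsmul_eq_mul] at htr
  have hd : (M.map (Int.cast : ℤ → ℂ)).det = (M.det : ℂ) :=
    ((Int.castRingHom ℂ).map_det M).symm
  rw [ha, Multiset.prod_replicate, hd] at hdet
  have ht : (M.map (Int.cast : ℤ → ℂ)).trace = (M.trace : ℂ) := by
    simp [trace]
  rw [ht] at htr
  -- The trace makes `a` real and the determinant makes it a root of unity.
  have hreal : a = (((M.trace : ℝ) / r : ℝ) : ℂ) := by
    push_cast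
    rw [htr]
    field_simp
  have hpow : a ^ (r * 2) = 1 := by
    rw [pow_mul, ← hdet]
    exact_mod_cast hM
  rw [hreal] at hpow ⊢
  have h2 : ((M.trace : ℝ) / r) ^ (r * 2) = 1 := by exact_mod_cast hpow
  have h3 : ((M.trace : ℝ) / r) ^ 2 = 1 := by
    rw [mul_comm, pow_mul] at h2
    exact (pow_eq_one_iff_of_nonneg (sq_nonneg _) hr).1 h2
  rcases mul_self_eq_one_iff.1 ((sq _).symm.trans h3) with h | h
  · left; rw [h]; simp
  · right; rw [h]; simp

/-- If `a` is the only eigenvalue, then modulo a given line there is an eigenvector outside it. -/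
theorem exists_generalized_eigenvector {N : Matrix (Fin r) (Fin r) ℂ} (hr : 2 ≤ r) {a : ℂ}
    (ha : N.charpoly.roots = Multiset.replicate r a) (f : Fin r → ℂ) :
    ∃ g, g ∉ Submodule.span ℂ {f} ∧ ∃ c : ℂ, N *ᵥ g = a • g + c • f := by
  classical
  have hnil : (N - a • 1) ^ r = 0 := by
    have h1 := (IsAlgClosed.splits N.charpoly).eq_prod_roots_of_monic N.charpoly_monic
    rw [ha, Multiset.map_replicate, Multiset.prod_replicate] at h1
    have h2 := aeval_self_charpoly N
    rw [h1] at h2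
    simpa [Algebra.algebraMap_eq_smul_one] using h2
  have htop : Submodule.span ℂ {f} ≠ ⊤ := by
    intro h
    have h1 := finrank_span_le_card (R := ℂ) ({f} : Set (Fin r → ℂ))
    rw [h, finrank_top] at h1
    simp at h1
    omega
  obtain ⟨h, hh⟩ := SetLike.exists_not_mem_of_ne_top _ htop rfl
  -- `N - a • 1` is nilpotent, so its powers carry `h` into the line; the last power outside the
  -- line is the required vector.
  have hex : ∃ k, (N - a • 1) ^ k *ᵥ h ∈ Submodule.span ℂ {f} := ⟨r, by simp [hnil]⟩
  obtain ⟨k, hk⟩ : ∃ k, Nat.find hex = k + 1 := Nat.exists_eq_succ_of_ne_zero fun h0 => by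
    have := Nat.find_spec hex
    rw [h0, pow_zero, one_mulVec] at this
    exact hh this
  refine ⟨(N - a • 1) ^ k *ᵥ h, Nat.find_min hex (by omega), ?_⟩
  have hs := Nat.find_spec hex
  rw [hk, pow_succ', ← mulVec_mulVec] at hs
  obtain ⟨c, hc⟩ := Submodule.mem_span_singleton.1 hs
  refine ⟨c, ?_⟩
  rw [hc, sub_mulVec, smul_mulVec, one_mulVec]
  abel

end Matrix

/-! ### Invariant forms and the `R_∞` property. -/

namespace FreeSolvableGroup

open IntLattice Matrix

variable {r t : ℕ} (ht : 2 ≤ t)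

theorem reidemeisterNumber_eq_top_of_form
    {φ : FreeSolvableGroup r t ≃* FreeSolvableGroup r t} {A : IntLattice r →* IntLattice r}
    (hA : ∀ g, coords ht (φ g) = A (coords ht g)) {ι : Type*} {S : Finset ι}
    {l : ι → Fin r → ℂ} (hl : ∀ i ∈ S, l i ≠ 0) {k : ℕ} (hS : S.card = k + 1) {i₀ : ι}
    (hi₀ : i₀ ∈ S) {b : Fin r → ℂ} {x y : Fin r} (hxy : b x * l i₀ y ≠ b y * l i₀ x)
    (W : IntLattice r → ℂ)
    (hW : ∀ i, (fun p => (∏ j ∈ S, l j ⬝ᵥ toComplex (A p)) * (b ⬝ᵥ toComplex (A (single i))) -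
      (∏ j ∈ S, l j ⬝ᵥ toComplex p) * b i - (W (p * single i) - W p)) ∈
        polyFun (IntLattice r) ℂ k) : reidemeisterNumber φ = ⊤ := by
  have hQ := prod_dotProduct_mem_polyFun S l
  rw [hS] at hQ
  have hJ := isPathIntegral ht (fun p => ∏ i ∈ S, l i ⬝ᵥ toComplex p) b
  have hJQ := hJ.mem_polyFun_of_closure (n := k + 1) closure_range_gen (by
    rintro _ ⟨i, rfl⟩
    convert (polyFun (IntLattice r) ℂ (k + 1)).smul_mem (b i) hQ using 1
    ext p
    simp [mul_comm])
  obtain ⟨z, hz, hne⟩ := exists_pathIntegral_ne ht b hl hS hi₀ hxy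
  exact reidemeisterNumber_eq_top φ (hJ.eval_mem_polyFun hJQ 1)
    (fun z hz => pathIntegral_invariant ht b hA hQ W hW hz)
    ⟨z, hz, by rwa [hJ.map_one]⟩

/-- The matrix of the endomorphism of `ℤ ^ r` induced by an endomorphism. -/
def inducedMatrix (φ : FreeSolvableGroup r t →* FreeSolvableGroup r t) :
    Matrix (Fin r) (Fin r) ℤ :=
  Matrix.of fun i j => (coords ht (φ (gen t j))).toAdd i

/-- The endomorphism of the multiplicative lattice given by a matrix. -/
def _root_.IntLattice.mulVecHom (M : Matrix (Fin r) (Fin r) ℤ) : IntLattice r →* IntLattice r :=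
  AddMonoidHom.toMultiplicative M.mulVecLin.toAddMonoidHom

theorem _root_.IntLattice.toComplex_mulVecHom (M : Matrix (Fin r) (Fin r) ℤ) (p : IntLattice r) :
    toComplex (mulVecHom M p) = M.map (Int.cast : ℤ → ℂ) *ᵥ toComplex p := by
  ext k
  simp [mulVecHom, toComplex, Matrix.mulVec, dotProduct]

theorem coords_map (φ : FreeSolvableGroup r t →* FreeSolvableGroup r t)
    (g : FreeSolvableGroup r t) :
    coords ht (φ g) = mulVecHom (inducedMatrix ht φ) (coords ht g) := by
  have : (coords ht).comp φ = (mulVecHom (inducedMatrix ht φ)).comp (coords ht) :=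
    hom_ext fun i => by
      refine Multiplicative.toAdd.injective (funext fun k => ?_)
      simp [mulVecHom, inducedMatrix, IntLattice.single]
  exact DFunLike.congr_fun this g

theorem det_inducedMatrix_sq (φ : FreeSolvableGroup r t ≃* FreeSolvableGroup r t) :
    (inducedMatrix ht φ.toMonoidHom).det ^ 2 = 1 := by
  have h : inducedMatrix ht φ.toMonoidHom * inducedMatrix ht φ.symm.toMonoidHom = 1 := by
    refine Matrix.ext_of_mulVec_single fun j => ?_
    have h1 := coords_map ht φ.toMonoidHom (φ.symm.toMonoidHom (gen t j))
    rw [coords_map ht φ.symm.toMonoidHom] at h1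
    have h2 : φ.toMonoidHom (φ.symm.toMonoidHom (gen t j)) = gen t j := φ.apply_symm_apply _
    rw [h2, coords_gen] at h1
    rw [← Matrix.mulVec_mulVec, Matrix.one_mulVec]
    exact (congrArg Multiplicative.toAdd h1).symm
  have hu : IsUnit (inducedMatrix ht φ.toMonoidHom).det :=
    Matrix.isUnit_det_of_right_inverse h
  rcases Int.isUnit_iff.1 hu with h | h <;> rw [h] <;> rfl

/-- Free solvable groups of rank and class at least two have the `R_∞` property. -/
theorem hasRInfty (hr : 2 ≤ r) (ht : 2 ≤ t) : HasRInfty (FreeSolvableGroup r t) := by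
  intro φ
  set M := inducedMatrix ht φ.toMonoidHom with hM
  have hA : ∀ g, coords ht (φ g) = mulVecHom M (coords ht g) := coords_map ht φ.toMonoidHom
  have hdet : M.det ^ 2 = 1 := det_inducedMatrix_sq ht φ
  -- The transpose describes the action on linear forms.
  set N : Matrix (Fin r) (Fin r) ℂ := (M.map Int.cast)ᵀ with hN
  have hdot : ∀ (v : Fin r → ℂ) (p : IntLattice r),
      v ⬝ᵥ toComplex (mulVecHom M p) = (N *ᵥ v) ⬝ᵥ toComplex p := fun v p => by
    rw [toComplex_mulVecHom, dotProduct_mulVec, hN, mulVec_transpose]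
  have hNM : N.charpoly = (M.map (Int.cast : ℤ → ℂ)).charpoly := charpoly_transpose _
  have hcard : N.charpoly.roots.card = r := by
    rw [← (IsAlgClosed.splits N.charpoly).natDegree_eq_card_roots, charpoly_natDegree_eq_dim,
      Fintype.card_fin]
  have hdetN : N.det = (M.det : ℂ) := by
    rw [hN, det_transpose]
    exact ((Int.castRingHom ℂ).map_det M).symm
  have hsingle : ∀ (v : Fin r → ℂ) (i : Fin r), v ⬝ᵥ toComplex (single i) = v i := fun v i => by
    rw [toComplex_single, dotProduct_single_one]
  let L := N.charpoly.roots.toList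
  have hLmem : ∀ i : Fin L.length, L.get i ∈ N.charpoly.roots := fun i =>
    Multiset.mem_toList.1 (List.get_mem L i)
  choose e he hNe using fun i => exists_eigenvector_of_mem_roots (hLmem i)
  by_cases hdist : ∃ i j, L.get i ≠ L.get j
  · obtain ⟨i₀, i₁, hne⟩ := hdist
    have hspan : e i₁ ∉ Submodule.span ℂ {e i₀} := by
      intro h
      obtain ⟨c, hc⟩ := Submodule.mem_span_singleton.1 h
      have h1 := hNe i₁
      rw [← hc, mulVec_smul, hNe, smul_comm, hc, ← sub_eq_zero, ← sub_smul, smul_eq_zero,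
        sub_eq_zero] at h1
      exact h1.elim hne (he i₁)
    obtain ⟨x, y, hxy⟩ := exists_minor_ne_zero (he i₀) hspan
    -- Each eigenvalue is taken twice because `det` may be `-1`. The omitted factor serves as `b`,
    -- and the factor at `i₁` makes the form non-closed.
    let S : Finset (Fin L.length × Bool) := Finset.univ.erase (i₀, false)
    have hi₁ : (i₁, false) ∈ S := by
      refine Finset.mem_erase.2 ⟨fun h => hne ?_, Finset.mem_univ _⟩
      exact congrArg L.get (congrArg Prod.fst h).symm
    obtain ⟨k, hk⟩ := Nat.exists_eq_succ_of_ne_zero (Finset.card_ne_zero_of_mem hi₁)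
    have hprod : (∏ j ∈ S, L.get j.1) * L.get i₀ = 1 := by
      have h1 := Finset.prod_erase_mul (Finset.univ : Finset (Fin L.length × Bool))
        (fun j => L.get j.1) (Finset.mem_univ (i₀, false))
      have h2 : ∏ i, L.get i = N.det := by
        rw [det_eq_prod_roots_charpoly, ← Multiset.prod_toList, ← List.prod_ofFn, List.ofFn_get]
      rw [h1, Fintype.prod_prod_type]
      simp only [Fintype.prod_bool]
      rw [Finset.prod_mul_distrib, h2, hdetN, ← sq]
      exact_mod_cast hdet
    refine reidemeisterNumber_eq_top_of_form ht hA (l := fun j => e j.1) (b := e i₀)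
      (fun j _ => he j.1) hk hi₁ hxy (fun _ => 0) fun i => ?_
    convert (polyFun (IntLattice r) ℂ k).zero_mem using 1
    ext p
    simp only [hdot, hNe, smul_dotProduct, smul_eq_mul, Finset.prod_mul_distrib, hsingle,
      Pi.zero_apply, Pi.smul_apply]
    linear_combination ((∏ j ∈ S, e j.1 ⬝ᵥ toComplex p) * e i₀ i) * hprod
  · push Not at hdist
    have hlen : L.length = r := by rw [Multiset.length_toList, hcard]
    let i₀ : Fin L.length := ⟨0, by omega⟩
    have hroots : N.charpoly.roots = Multiset.replicate r (L.get i₀) := by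
      refine Multiset.eq_replicate.2 ⟨hcard, fun a ha => ?_⟩
      obtain ⟨j, rfl⟩ := List.get_of_mem (Multiset.mem_toList.2 ha)
      exact hdist j i₀
    rcases eq_one_or_neg_one_of_roots_eq (by omega) hdet (hNM ▸ hroots) with h1 | h1
    · have hNe1 := hNe i₀
      rw [h1, one_smul] at hNe1
      refine reidemeisterNumber_eq_top φ (n := 0)
        (polyFun_comp (dotProduct_mem_polyFun (e i₀)) (coords ht)) (fun z _ => ?_) ?_
      · rw [hA, hdot, hNe1]
      · obtain ⟨x, hx⟩ := Function.ne_iff.1 (he i₀)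
        refine ⟨gen t x, by rw [polySubgroup_zero]; trivial, ?_⟩
        simpa [hsingle, toComplex_one] using hx
    · obtain ⟨g, hg, c, hgc⟩ := exists_generalized_eigenvector hr hroots (e i₀)
      have hNe1 := hNe i₀
      rw [h1] at hNe1 hgc
      obtain ⟨x, y, hxy⟩ := exists_minor_ne_zero (he i₀) hg
      -- The form `g · e` is carried to `g · e - c e · e`, and `e · e` is, up to lower degree, the
      -- differential of half the square of `e`; this dictates the potential.
      refine reidemeisterNumber_eq_top_of_form ht hA (S := {()}) (l := fun _ => g) (b := e i₀)
        (k := 0) (fun _ _ h => hg (h ▸ Submodule.zero_mem _)) rfl (Finset.mem_singleton_self ())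
        hxy (fun p => -(c / 2) * (e i₀ ⬝ᵥ toComplex p) ^ 2) fun i => ?_
      convert const_mem_polyFun (G := IntLattice r) 0 (c / 2 * e i₀ i ^ 2) using 1
      ext p
      simp only [hdot, hNe1, hgc, Finset.prod_singleton, add_dotProduct, smul_dotProduct,
        smul_eq_mul, hsingle, toComplex_mul, dotProduct_add, Pi.smul_apply]
      ring

end FreeSolvableGroup

theorem theorem2 :
    ((∀ t : ℕ, 2 ≤ t → HasRInfty (FreeSolvableGroup 2 t)) ∧ HasRInfty (FreeMetabelianGroup 2)) ∧
    (∀ t : ℕ, 4 ≤ t → HasRInfty (FreeSolvableGroup 3 t)) ∧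
    (∀ r t : ℕ, 4 ≤ r → Real.logb 2 (2 * (r : ℝ) + 1) ≤ (t : ℝ) →
      HasRInfty (FreeSolvableGroup r t)) := by
  refine ⟨⟨fun t ht => FreeSolvableGroup.hasRInfty le_rfl ht,
    FreeSolvableGroup.hasRInfty le_rfl le_rfl⟩,
    fun t ht => FreeSolvableGroup.hasRInfty (by norm_num) (by omega), fun r t hr hlog => ?_⟩
  refine FreeSolvableGroup.hasRInfty (by omega) ?_
  -- The logarithmic bound serves only to give `2 ≤ t`: for `t ≤ 1` it would yield `2 * r + 1 ≤ 2`.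
  by_contra! ht
  have hr' : (4 : ℝ) ≤ r := by exact_mod_cast hr
  have ht' : (t : ℝ) ≤ 1 := by exact_mod_cast Nat.lt_succ_iff.1 ht
  have h := (Real.logb_le_iff_le_rpow one_lt_two (by linarith)).1 (hlog.trans ht')
  rw [Real.rpow_one] at h
  linarith
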